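/- Let $\mathbb{X}$ be a Polish space with Borel $\sigma$-algebra $\mathcal{B}(\mathbb{X})$, and let $Q$ be a Markov transition kernel on $\mathbb{X}$. For each $x\in\mathbb{X}$ let $X^x=(X^x_t)_{t=0,1,2,\dots}$ be a time-homogeneous Markov process with transition kernel $Q$ (with respect to the filtration it generates) and $X^x_0=x$ a.s. Let $f:\mathbb{X}\to\mathbb{R}$ be nonnegative, bounded and Borel measurable, and let $\delta:\{0,1,2,\dots\}\to[0,1]$ be strictly decreasing with $\delta(0)=1$ and $\lim_{k\to\infty}\delta(k)=0$. For $x\in\mathbb{X}$ and $S\in\mathcal{B}(\mathbb{X})$ put $$\rho(x,S):=\inf\{t\ge 1: X^x_t\in S\},\qquad J(x,\rho(x,S)):=\mathbb{E}\big[\delta(\rho(x,S))\,f(X^x_{\rho(x,S)})\big],$$ where the integrand is $0$ on $\{\rho(x,S)=\infty\}$, and $$\Theta(S):=\{x\in\mathbb{X}: f(x)\ge J(x,\rho(x,S))\},\qquad V(x,S):=\max\{f(x),J(x,\rho(x,S))\}.$$ A set $S\in\mathcal{B}(\mathbb{X})$ is an equilibrium if $\Theta(S)=S$; let $\mathcal{E}$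 be the set of all equilibria. An equilibrium $S'$ is optimal if $V(x,S')\ge V(x,S)$ for all $x\in\mathbb{X}$ and all $S\in\mathcal{E}$. Theorem. Suppose that $\delta(i)\delta(j)\le\delta(i+j)$ for all $i,j\ge 0$, that $f$ is lower semicontinuous, and that for every bounded Borel measurable $g:\mathbb{X}\to\mathbb{R}$ and every sequence $x_n\to x$ in $\mathbb{X}$, $$\liminf_{n\to\infty}\int_{\mathbb{X}} g(y)\,Q(x_n,dy)\ \ge\ \int_{\mathbb{X}} g(y)\,Q(x,dy).$$ Then $S^*:=\bigcap_{S\in\mathcal{E}}S$ is an optimal equilibrium (in particular, it is Borel and $\Theta(S^*)=S^*$), and it is the only optimal equilibrium. -/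

import Mathlib

open MeasureTheory ProbabilityTheory Filter Topology

noncomputable section

namespace StoppingGame

variable {𝕏 Ω : Type*} [MeasurableSpace 𝕏] [MeasurableSpace Ω]

/-- Under `μ`, the process `Y` is a time-homogeneous Markov process (with respect to the filtration
it generates) with transition kernel `Q`, started at `x`:
`Y 0 = x` almost surely, and `μ (Y (t+1) ∈ A | Y 0, …, Y t) = Q (Y t) A` almost surely. -/
structure IsMarkovFrom (Q : Kernel 𝕏 𝕏) (μ : Measure Ω) (Y : ℕ → Ω → 𝕏) (x : 𝕏) : Prop where
  measurable : ∀ t, Measurable (Y t)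
  start : ∀ᵐ ω ∂μ, Y 0 ω = x
  markov : ∀ (t : ℕ) (A : Set 𝕏), MeasurableSet A →
    μ⟦Y (t + 1) ⁻¹' A | ⨆ s ≤ t, MeasurableSpace.comap (Y s) inferInstance⟧
      =ᵐ[μ] fun ω => (Q (Y t ω)).real A

/-- Lower semicontinuity of the kernel: `liminf ∫ g dQ(xₙ) ≥ ∫ g dQ(x)` for every bounded
measurable `g` and every sequence `xₙ → x`. -/
def KernelLSC [TopologicalSpace 𝕏] (Q : Kernel 𝕏 𝕏) : Prop :=
  ∀ g : 𝕏 → ℝ, Measurable g → (∃ C : ℝ, ∀ y, |g y| ≤ C) →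
    ∀ (u : ℕ → 𝕏) (x : 𝕏), Tendsto u atTop (𝓝 x) →
      ∫ y, g y ∂(Q x) ≤ liminf (fun n => ∫ y, g y ∂(Q (u n))) atTop

/-- A discount function `δ : {0, 1, 2, …} → [0, 1]`. -/
structure IsDiscount (δ : ℕ → ℝ) : Prop where
  mem_Icc : ∀ k, δ k ∈ Set.Icc (0 : ℝ) 1
  strictAnti : StrictAnti δ
  zero : δ 0 = 1
  tendsto_zero : Tendsto δ atTop (𝓝 0)

/-- The discounted payoff `δ(τ) f(Y_τ)`, equal to `0` where `τ = ∞`. -/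
def discountedPayoff (δ : ℕ → ℝ) (f : 𝕏 → ℝ) (Y : ℕ → Ω → 𝕏) (τ : Ω → WithTop ℕ) (ω : Ω) : ℝ :=
  match τ ω with
  | ⊤ => 0
  | (t : ℕ) => δ t * f (Y t ω)

/-- `J(x, τ) = 𝔼ˣ[δ(τ) f(X_τ)]`; the process started at `x` is `X x`, under the law `P x`. -/
def J (δ : ℕ → ℝ) (f : 𝕏 → ℝ) (P : 𝕏 → Measure Ω) (X : 𝕏 → ℕ → Ω → 𝕏)
    (x : 𝕏) (τ : Ω → WithTop ℕ) : ℝ :=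
  ∫ ω, discountedPayoff δ f (X x) τ ω ∂(P x)

/-- `ρ(x, S) = inf {t ≥ 1 : Xˣ_t ∈ S}`. -/
def rho (X : 𝕏 → ℕ → Ω → 𝕏) (x : 𝕏) (S : Set 𝕏) : Ω → WithTop ℕ :=
  hittingAfter (X x) S 1

/-- `Θ(S) = {x : f(x) ≥ J(x, ρ(x, S))}`. -/
def Theta (δ : ℕ → ℝ) (f : 𝕏 → ℝ) (P : 𝕏 → Measure Ω) (X : 𝕏 → ℕ → Ω → 𝕏)
    (S : Set 𝕏) : Set 𝕏 :=
  {x | J δ f P X x (rho X x S) ≤ f x}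

/-- The set of all equilibria: Borel sets `S` with `Θ(S) = S`. -/
def equilibria (δ : ℕ → ℝ) (f : 𝕏 → ℝ) (P : 𝕏 → Measure Ω) (X : 𝕏 → ℕ → Ω → 𝕏) :
    Set (Set 𝕏) :=
  {S | MeasurableSet S ∧ Theta δ f P X S = S}

/-- The value `V(x, S) = f(x) ∨ J(x, ρ(x, S))`. -/
def V (δ : ℕ → ℝ) (f : 𝕏 → ℝ) (P : 𝕏 → Measure Ω) (X : 𝕏 → ℕ → Ω → 𝕏)
    (x : 𝕏) (S : Set 𝕏) : ℝ :=
  max (f x) (J δ f P X x (rho X x S))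

/-- An optimal equilibrium: an equilibrium whose value dominates, at every state, that of every
equilibrium. -/
def IsOptimalEquilibrium (δ : ℕ → ℝ) (f : 𝕏 → ℝ) (P : 𝕏 → Measure Ω) (X : 𝕏 → ℕ → Ω → 𝕏)
    (S' : Set 𝕏) : Prop :=
  S' ∈ equilibria δ f P X ∧
    ∀ S ∈ equilibria δ f P X, ∀ x, V δ f P X x S ≤ V δ f P X x S'

end StoppingGame

end

open scoped ENNReal

/-! Write Φ_S(x) for J(x, ρ(x,S)); it is a series determined by Q alone (`J_rho_eq`). If R ⊆ A, the
process meets A no later than R, and δ(i)δ(j) ≤ δ(i+j) says that discounting in two stages, up to A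
and then on to R, can only lose value (`discountedHit_add_le_of_subset`). Hence, if off R stopping
is no better than waiting for suitable B_i ⊇ R, a bound Φ_{B_i} ≤ Φ_R + D improves itself to Φ_R +
δ(1)D; as δ(1) < 1, iteration gives Φ_{B_i} ≤ Φ_R (`discountedHit_le_of_forall_notMem`).

Consider the class W of Borel sets S with f < Φ_S off S. It contains all equilibria, and Θ maps it
into itself with Θ(S) ⊆ S. So ⋂W = {sup_W Φ_S ≤ f}, and this possibly uncountable intersection is
Borel because every Φ_S is lower semicontinuous. The comparison puts ⋂W in W with the largest value;
minimality makes it a fixed point of Θ, hence the least equilibrium (`sInter_strictWaitingSets`). -/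

namespace StoppingGame

/-! ### Hitting series of a kernel and comparison of nested sets -/

section Analytic

variable {𝕏 : Type*} [MeasurableSpace 𝕏]

/-- The expectation of `φ` at the first hitting time of `S` after time `0`, restricted to the event
that this time is `n + 1`, as a function of the starting point. -/
noncomputable def hitTerm (Q : Kernel 𝕏 𝕏) (S : Set 𝕏) (φ : 𝕏 → ℝ≥0∞) : ℕ → 𝕏 → ℝ≥0∞
  | 0 => fun x => ∫⁻ y, S.indicator φ y ∂(Q x)
  | n + 1 => fun x => ∫⁻ y, Sᶜ.indicator (hitTerm Q S φ n) y ∂(Q x)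

/-- The expected discounted value of `φ` at the first hitting time of `S` after time `0`. -/
noncomputable def discountedHit (d : ℕ → ℝ≥0∞) (Q : Kernel 𝕏 𝕏) (S : Set 𝕏) (φ : 𝕏 → ℝ≥0∞)
    (x : 𝕏) : ℝ≥0∞ :=
  ∑' n, d (n + 1) * hitTerm Q S φ n x

variable {Q : Kernel 𝕏 𝕏} {S A R : Set 𝕏} {φ ψ : 𝕏 → ℝ≥0∞} {d : ℕ → ℝ≥0∞}

theorem measurable_hitTerm (hS : MeasurableSet S) (hφ : Measurable φ) (n : ℕ) :
    Measurable (hitTerm Q S φ n) := by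
  induction n with
  | zero => exact (hφ.indicator hS).lintegral_kernel
  | succ n ih => exact (ih.indicator hS.compl).lintegral_kernel

theorem measurable_discountedHit (hS : MeasurableSet S) (hφ : Measurable φ) :
    Measurable (discountedHit d Q S φ) :=
  Measurable.tsum fun n => (measurable_hitTerm hS hφ n).const_mul _

theorem hitTerm_mono (h : ∀ y ∈ S, φ y ≤ ψ y) (n : ℕ) (x : 𝕏) :
    hitTerm Q S φ n x ≤ hitTerm Q S ψ n x := by
  induction n generalizing x with
  | zero =>
    refine lintegral_mono fun y => ?_
    by_cases hy : y ∈ S <;> simp [hy, h]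
  | succ n ih => exact lintegral_mono fun y => Set.indicator_le_indicator (ih y)

theorem hitTerm_tsum {g : ℕ → 𝕏 → ℝ≥0∞} (hS : MeasurableSet S) (hg : ∀ j, Measurable (g j))
    (n : ℕ) (x : 𝕏) :
    hitTerm Q S (fun y => ∑' j, g j y) n x = ∑' j, hitTerm Q S (g j) n x := by
  have key : ∀ (T : Set 𝕏) (u : ℕ → 𝕏 → ℝ≥0∞) (y : 𝕏),
      T.indicator (fun y => ∑' j, u j y) y = ∑' j, T.indicator (u j) y := by
    intro T u y
    by_cases hy : y ∈ T <;> simp [hy]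
  induction n generalizing x with
  | zero =>
    simp only [hitTerm, key]
    exact lintegral_tsum fun j => ((hg j).indicator hS).aemeasurable
  | succ n ih =>
    have : hitTerm Q S (fun y => ∑' j, g j y) n = fun y => ∑' j, hitTerm Q S (g j) n y :=
      funext ih
    simp only [hitTerm, this, key]
    exact lintegral_tsum fun j => ((measurable_hitTerm hS (hg j) n).indicator hS.compl).aemeasurable

theorem hitTerm_add (hS : MeasurableSet S) (hφ : Measurable φ) (n : ℕ) (x : 𝕏) :
    hitTerm Q S (fun y => φ y + ψ y) n x = hitTerm Q S φ n x + hitTerm Q S ψ n x := by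
  have key : ∀ (T : Set 𝕏) (u v : 𝕏 → ℝ≥0∞) (y : 𝕏),
      T.indicator (fun y => u y + v y) y = T.indicator u y + T.indicator v y := by
    intro T u v y
    by_cases hy : y ∈ T <;> simp [hy]
  induction n generalizing x with
  | zero =>
    simp only [hitTerm, key]
    exact lintegral_add_left (hφ.indicator hS) _
  | succ n ih =>
    have : hitTerm Q S (fun y => φ y + ψ y) n = fun y => hitTerm Q S φ n y + hitTerm Q S ψ n y :=
      funext ih
    simp only [hitTerm, this, key]
    exact lintegral_add_left ((measurable_hitTerm hS hφ n).indicator hS.compl) _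

theorem hitTerm_const_mul (hS : MeasurableSet S) (hφ : Measurable φ) (c : ℝ≥0∞) (n : ℕ) (x : 𝕏) :
    hitTerm Q S (fun y => c * φ y) n x = c * hitTerm Q S φ n x := by
  have key : ∀ (T : Set 𝕏) (u : 𝕏 → ℝ≥0∞) (y : 𝕏),
      T.indicator (fun y => c * u y) y = c * T.indicator u y := by
    intro T u y
    by_cases hy : y ∈ T <;> simp [hy]
  induction n generalizing x with
  | zero =>
    simp only [hitTerm, key]
    exact lintegral_const_mul _ (hφ.indicator hS)
  | succ n ih =>
    have : hitTerm Q S (fun y => c * φ y) n = fun y => c * hitTerm Q S φ n y := funext ih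
    simp only [hitTerm, this, key]
    exact lintegral_const_mul _ ((measurable_hitTerm hS hφ n).indicator hS.compl)

theorem lintegral_indicator_finset_sum {ι : Type*} (s : Finset ι) {g : ι → 𝕏 → ℝ≥0∞}
    (hg : ∀ j, Measurable (g j)) (x : 𝕏) (hS : MeasurableSet S) :
    ∫⁻ y, S.indicator (fun y => ∑ j ∈ s, g j y) y ∂(Q x)
      = ∑ j ∈ s, ∫⁻ y, S.indicator (g j) y ∂(Q x) := by
  rw [← lintegral_finsetSum _ fun j _ => (hg j).indicator hS]
  refine lintegral_congr fun y => ?_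
  by_cases hy : y ∈ S <;> simp [hy]

/-- These are probabilities of disjoint events. Conditioning on the first step gives a proof without
any process: the mass landing in S counts once, the rest at most once by induction. -/
theorem sum_hitTerm_one_le [IsMarkovKernel Q] (hS : MeasurableSet S) (n : ℕ) (x : 𝕏) :
    ∑ i ∈ Finset.range n, hitTerm Q S (fun _ => 1) i x ≤ 1 := by
  induction n generalizing x with
  | zero => simp
  | succ n ih =>
    rw [Finset.sum_range_succ']
    simp only [hitTerm]
    rw [← lintegral_indicator_finset_sum _
        (fun j => measurable_hitTerm hS measurable_const j) x hS.compl,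
      ← lintegral_add_right _ (measurable_const.indicator hS)]
    calc _ ≤ ∫⁻ _, 1 ∂(Q x) := by
          refine lintegral_mono fun y => ?_
          by_cases hy : y ∈ S <;> simp [hy, ih]
      _ = 1 := by simp

theorem tsum_hitTerm_one_le [IsMarkovKernel Q] (hS : MeasurableSet S) (x : 𝕏) :
    ∑' i, hitTerm Q S (fun _ => 1) i x ≤ 1 :=
  ENNReal.tsum_le_of_sum_range_le fun n => sum_hitTerm_one_le hS n x

/-- Source of the contraction: a hit costs at least one period, hence a factor `d 1`. -/
theorem discountedHit_const_le [IsMarkovKernel Q] (hS : MeasurableSet S)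
    (hd : ∀ n, d (n + 1) ≤ d 1) (c : ℝ≥0∞) (x : 𝕏) :
    discountedHit d Q S (fun _ => c) x ≤ d 1 * c := by
  have h : ∀ n, hitTerm Q S (fun _ => c) n x = c * hitTerm Q S (fun _ => 1) n x := fun n => by
    simpa using hitTerm_const_mul (Q := Q) hS (measurable_const (a := (1 : ℝ≥0∞))) c n x
  calc discountedHit d Q S (fun _ => c) x
      ≤ ∑' n, (d 1 * c) * hitTerm Q S (fun _ => 1) n x := by
        refine ENNReal.tsum_le_tsum fun n => ?_
        rw [h, ← mul_assoc]
        gcongr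
        exact hd n
    _ ≤ d 1 * c := by
        rw [ENNReal.tsum_mul_left]
        exact mul_le_of_le_one_right' (tsum_hitTerm_one_le hS x)

theorem discountedHit_mono (h : ∀ y ∈ S, φ y ≤ ψ y) (x : 𝕏) :
    discountedHit d Q S φ x ≤ discountedHit d Q S ψ x :=
  ENNReal.tsum_le_tsum fun n => by gcongr; exact hitTerm_mono h n x

theorem discountedHit_add (hS : MeasurableSet S) (hφ : Measurable φ) (x : 𝕏) :
    discountedHit d Q S (fun y => φ y + ψ y) x
      = discountedHit d Q S φ x + discountedHit d Q S ψ x := by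
  simp only [discountedHit, hitTerm_add hS hφ, mul_add, ENNReal.tsum_add]

theorem discountedHit_le [IsMarkovKernel Q] (hS : MeasurableSet S)
    (hd : ∀ n, d (n + 1) ≤ d 1) (hd1 : d 1 ≤ 1) {c : ℝ≥0∞} (hφ : ∀ y, φ y ≤ c) (x : 𝕏) :
    discountedHit d Q S φ x ≤ c :=
  (discountedHit_mono (fun y _ => hφ y) x).trans
    ((discountedHit_const_le hS hd c x).trans (mul_le_of_le_one_left' hd1))

theorem hitTerm_zero_eq_of_subset (hRA : R ⊆ A) (x : 𝕏) :
    hitTerm Q R φ 0 x = hitTerm Q A (R.indicator φ) 0 x := by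
  simp only [hitTerm]
  refine lintegral_congr fun y => ?_
  by_cases hy : y ∈ A
  · simp [hy]
  · have hy' : y ∉ R := fun h => hy (hRA h)
    simp [hy, hy']

/-- First-hit decomposition: before hitting `R ⊆ A` the process hits `A`. -/
theorem hitTerm_succ_eq_of_subset (hRA : R ⊆ A) (hR : MeasurableSet R) (hA : MeasurableSet A)
    (hφ : Measurable φ) (n : ℕ) (x : 𝕏) :
    hitTerm Q R φ (n + 1) x = hitTerm Q A (R.indicator φ) (n + 1) x
      + ∑ p ∈ Finset.HasAntidiagonal.antidiagonal n,
          hitTerm Q A (Rᶜ.indicator (hitTerm Q R φ p.2)) p.1 x := by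
  have hm : ∀ n, Measurable (hitTerm Q R φ n) := measurable_hitTerm hR hφ
  have hmA : ∀ p : ℕ × ℕ, Measurable (hitTerm Q A (Rᶜ.indicator (hitTerm Q R φ p.2)) p.1) :=
    fun p => measurable_hitTerm hA ((hm p.2).indicator hR.compl) p.1
  -- A first step that misses R either misses A too or lands in A \ R.
  have split : ∀ n x, hitTerm Q R φ (n + 1) x = ∫⁻ y, Aᶜ.indicator (hitTerm Q R φ n) y ∂(Q x)
      + hitTerm Q A (Rᶜ.indicator (hitTerm Q R φ n)) 0 x := by
    intro n x
    simp only [hitTerm]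
    rw [← lintegral_add_left ((hm n).indicator hA.compl)]
    refine lintegral_congr fun y => ?_
    by_cases hy : y ∈ A
    · simp [hy]
    · have hy' : y ∉ R := fun h => hy (hRA h)
      simp [hy, hy']
  induction n generalizing x with
  | zero =>
    rw [split]
    simp only [Finset.HasAntidiagonal.antidiagonal_zero, Finset.sum_singleton]
    congr 1
    rw [funext fun x => hitTerm_zero_eq_of_subset (Q := Q) (φ := φ) hRA x]
    rfl
  | succ n ih =>
    have : ∀ y, Aᶜ.indicator (fun x => hitTerm Q A (R.indicator φ) (n + 1) x
        + ∑ p ∈ Finset.HasAntidiagonal.antidiagonal n,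
          hitTerm Q A (Rᶜ.indicator (hitTerm Q R φ p.2)) p.1 x) y
        = Aᶜ.indicator (hitTerm Q A (R.indicator φ) (n + 1)) y
        + Aᶜ.indicator (fun x => ∑ p ∈ Finset.HasAntidiagonal.antidiagonal n,
            hitTerm Q A (Rᶜ.indicator (hitTerm Q R φ p.2)) p.1 x) y := by
      intro y
      by_cases hy : y ∈ A <;> simp [hy]
    have hn : ∫⁻ y, Aᶜ.indicator (hitTerm Q R φ (n + 1)) y ∂(Q x)
        = hitTerm Q A (R.indicator φ) (n + 2) x + ∑ p ∈ Finset.HasAntidiagonal.antidiagonal n,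
          hitTerm Q A (Rᶜ.indicator (hitTerm Q R φ p.2)) (p.1 + 1) x := by
      rw [funext ih]
      simp only [this]
      rw [lintegral_add_left ((measurable_hitTerm hA (hφ.indicator hR) _).indicator hA.compl),
        lintegral_indicator_finset_sum _ hmA x hA.compl]
      rfl
    rw [split, hn, Finset.Nat.sum_antidiagonal_succ, add_assoc, add_comm (hitTerm Q A _ 0 x)]

/-- Under decreasing impatience, re-evaluating at the first hit of `A ⊇ R` the value of waiting
for `R` cannot exceed the value of waiting for `R` from the start. -/
theorem discountedHit_add_le_of_subset (hd : ∀ i j, d i * d j ≤ d (i + j)) (hRA : R ⊆ A)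
    (hR : MeasurableSet R) (hA : MeasurableSet A) (hφ : Measurable φ) (x : 𝕏) :
    discountedHit d Q A (R.indicator φ) x
      + discountedHit d Q A (Rᶜ.indicator (discountedHit d Q R φ)) x
      ≤ discountedHit d Q R φ x := by
  have hm : ∀ n, Measurable (Rᶜ.indicator (hitTerm Q R φ n)) := fun n =>
    (measurable_hitTerm hR hφ n).indicator hR.compl
  set H : ℕ × ℕ → ℝ≥0∞ := fun p => hitTerm Q A (Rᶜ.indicator (hitTerm Q R φ p.2)) p.1 x with hH
  have expand : Rᶜ.indicator (discountedHit d Q R φ)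
      = fun y => ∑' j, d (j + 1) * Rᶜ.indicator (hitTerm Q R φ j) y := by
    funext y
    by_cases hy : y ∈ R <;> simp [hy, discountedHit]
  have second : discountedHit d Q A (Rᶜ.indicator (discountedHit d Q R φ)) x
      ≤ ∑' n, d (n + 2) * ∑ p ∈ Finset.HasAntidiagonal.antidiagonal n, H p := by
    calc _ = ∑' i, ∑' j, d (i + 1) * (d (j + 1) * H (i, j)) := by
          simp only [discountedHit] at expand ⊢
          rw [expand]
          simp only [hitTerm_tsum hA fun j => (hm j).const_mul _, hitTerm_const_mul hA (hm _),
            ENNReal.tsum_mul_left, hH]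
      -- Decreasing impatience: A is hit after i + 1 steps, R after j + 1 more.
      _ ≤ ∑' i, ∑' j, d (i + j + 2) * H (i, j) := by
          refine ENNReal.tsum_le_tsum fun i => ENNReal.tsum_le_tsum fun j => ?_
          rw [← mul_assoc]
          gcongr
          exact (hd _ _).trans_eq (by congr 1; ring)
      _ = ∑' p : ℕ × ℕ, d (p.1 + p.2 + 2) * H p := (ENNReal.tsum_prod
          (f := fun i j => d (i + j + 2) * H (i, j))).symm
      _ = ∑' n, ∑ p ∈ Finset.HasAntidiagonal.antidiagonal n, d (p.1 + p.2 + 2) * H p := by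
          rw [← Finset.HasAntidiagonal.sigmaAntidiagonalEquivProd.tsum_eq
            (fun p : ℕ × ℕ => d (p.1 + p.2 + 2) * H p), ENNReal.tsum_sigma']
          refine tsum_congr fun n => ?_
          rw [← Finset.sum_coe_sort, tsum_fintype]
          rfl
      _ = ∑' n, d (n + 2) * ∑ p ∈ Finset.HasAntidiagonal.antidiagonal n, H p := by
          refine tsum_congr fun n => ?_
          rw [Finset.mul_sum]
          refine Finset.sum_congr rfl fun p hp => ?_
          rw [Finset.HasAntidiagonal.mem_antidiagonal.1 hp]
  refine (add_le_add_right second _).trans_eq ?_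
  simp only [discountedHit]
  -- The first terms agree: a hit of R at time 1 is also the first hit of A. The antidiagonal sums
  -- start only at time 2.
  rw [tsum_eq_zero_add' ENNReal.summable, tsum_eq_zero_add' (f := fun n => d (n + 1) *
    hitTerm Q R φ n x) ENNReal.summable, hitTerm_zero_eq_of_subset hRA, add_assoc,
    ← ENNReal.tsum_add]
  congr 1
  refine tsum_congr fun n => ?_
  rw [hitTerm_succ_eq_of_subset hRA hR hA hφ, mul_add]

/-- If outside `R` stopping immediately is no better than waiting for one of the sets `A i ⊇ R`,
then waiting for `R` is at least as good as waiting for any of the sets `A i`. -/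
theorem discountedHit_le_of_forall_notMem {ι : Sort*} [IsMarkovKernel Q]
    (hd : ∀ i j, d i * d j ≤ d (i + j)) (hd' : ∀ n, d (n + 1) ≤ d 1) (hd1 : d 1 < 1)
    {B : ι → Set 𝕏} (hRB : ∀ i, R ⊆ B i) (hR : MeasurableSet R) (hB : ∀ i, MeasurableSet (B i))
    (hφ : Measurable φ) {c : ℝ≥0∞} (hc : c ≠ ∞) (hφc : ∀ y, φ y ≤ c)
    (h : ∀ y ∉ R, φ y ≤ ⨆ i, discountedHit d Q (B i) φ y) (i : ι) (x : 𝕏) :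
    discountedHit d Q (B i) φ x ≤ discountedHit d Q R φ x := by
  -- The error must be uniform in i and x: off R, φ is bounded by a supremum over all i, so the
  -- bound is reused there for every index.
  have step : ∀ D : ℝ≥0∞,
      (∀ i x, discountedHit d Q (B i) φ x ≤ discountedHit d Q R φ x + D) →
      ∀ i x, discountedHit d Q (B i) φ x ≤ discountedHit d Q R φ x + d 1 * D := by
    intro D hD i x
    have hm := measurable_discountedHit (d := d) (Q := Q) hR hφ
    calc discountedHit d Q (B i) φ x
        ≤ discountedHit d Q (B i) (fun y => (R.indicator φ y
            + Rᶜ.indicator (discountedHit d Q R φ) y) + D) x := by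
          refine discountedHit_mono (fun y _ => ?_) x
          by_cases hy : y ∈ R
          · simp [hy]
          · simpa [hy] using (h y hy).trans (iSup_le fun i => hD i y)
      _ = (discountedHit d Q (B i) (R.indicator φ) x
            + discountedHit d Q (B i) (Rᶜ.indicator (discountedHit d Q R φ)) x)
            + discountedHit d Q (B i) (fun _ => D) x := by
          rw [discountedHit_add (φ := fun y => R.indicator φ y
              + Rᶜ.indicator (discountedHit d Q R φ) y) (hB i)
              ((hφ.indicator hR).add (hm.indicator hR.compl)),
            discountedHit_add (hB i) (hφ.indicator hR)]
      _ ≤ discountedHit d Q R φ x + d 1 * D :=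
          add_le_add (discountedHit_add_le_of_subset hd (hRB i) hR (hB i) hφ x)
            (discountedHit_const_le (hB i) hd' D x)
  have iter : ∀ n : ℕ, ∀ i x, discountedHit d Q (B i) φ x
      ≤ discountedHit d Q R φ x + d 1 ^ n * c := by
    intro n
    induction n with
    | zero =>
      intro i x
      simpa using le_add_left (discountedHit_le (hB i) hd' hd1.le hφc x)
    | succ n ih =>
      intro i x
      simpa [pow_succ', mul_assoc] using step _ ih i x
  refine ge_of_tendsto' (x := atTop)
    (f := fun n : ℕ => discountedHit d Q R φ x + d 1 ^ n * c) ?_ fun n => iter n i x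
  have := ENNReal.Tendsto.mul_const (ENNReal.tendsto_pow_atTop_nhds_zero_of_lt_one hd1)
    (Or.inr hc) (b := c)
  simpa using this.const_add (discountedHit d Q R φ x)

end Analytic

/-! ### The one-step Markov property -/

section Mark
variable {𝕏 Ω : Type*} [MeasurableSpace 𝕏] [MeasurableSpace Ω]

/-- The one-step Markov property for nonnegative functions of the next state. -/
theorem IsMarkovFrom.setLIntegral_succ {Q : Kernel 𝕏 𝕏} [IsMarkovKernel Q] {μ : Measure Ω}
    [IsProbabilityMeasure μ] {Y : ℕ → Ω → 𝕏} {x : 𝕏} (h : IsMarkovFrom Q μ Y x) (t : ℕ)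
    {E : Set Ω} (hE : MeasurableSet[⨆ s ≤ t, MeasurableSpace.comap (Y s) inferInstance] E)
    {g : 𝕏 → ℝ≥0∞} (hg : Measurable g) :
    ∫⁻ ω in E, g (Y (t + 1) ω) ∂μ = ∫⁻ ω in E, ∫⁻ y, g y ∂(Q (Y t ω)) ∂μ := by
  have hle : (⨆ s ≤ t, MeasurableSpace.comap (Y s) inferInstance) ≤ ‹MeasurableSpace Ω› :=
    iSup₂_le fun s _ => (h.measurable s).comap_le
  have hQ : Measurable fun ω => Q (Y t ω) := Q.measurable.comp (h.measurable t)
  -- The hypothesis speaks of events only; as an equality of measures it extends to every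
  -- nonnegative g.
  have key : (μ.restrict E).map (Y (t + 1)) = (μ.restrict E).bind fun ω => Q (Y t ω) := by
    ext A hA
    rw [Measure.map_apply (h.measurable _) hA, Measure.bind_apply hA hQ.aemeasurable]
    have hA' : MeasurableSet (Y (t + 1) ⁻¹' A) := h.measurable _ hA
    have h1 := setIntegral_condExp (μ := μ) hle
      (f := (Y (t + 1) ⁻¹' A).indicator fun _ => (1 : ℝ))
      ((integrable_const _).indicator hA') hE
    rw [setIntegral_congr_ae (g := fun ω => (Q (Y t ω)).real A) (hle _ hE)
      ((h.markov t A hA).mono fun ω hω _ => hω)] at h1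
    rw [integral_indicator_const _ hA', smul_eq_mul, mul_one] at h1
    have hmeas : Measurable fun ω => Q (Y t ω) A := (Measure.measurable_coe hA).comp hQ
    have h2 : ∫ ω in E, (Q (Y t ω)).real A ∂μ = (∫⁻ ω in E, Q (Y t ω) A ∂μ).toReal :=
      integral_toReal hmeas.aemeasurable (ae_of_all _ fun ω => measure_lt_top _ _)
    rw [h2] at h1
    refine ((ENNReal.toReal_eq_toReal_iff' (measure_ne_top _ _) ?_).1 h1.symm)
    refine ((lintegral_mono fun ω => prob_le_one).trans_lt
      (b := ∫⁻ _ in E, (1 : ℝ≥0∞) ∂μ) ?_).ne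
    simp
  rw [← lintegral_map hg (h.measurable _), key, Measure.lintegral_bind hQ.aemeasurable
    hg.aemeasurable]

end Mark

/-! ### From the process to the hitting series -/

section Hitting

variable {𝕏 Ω : Type*}

/-- The event that the first visit to `S` after time `s` takes place at time `s + n + 1`. -/
def firstHit (Y : ℕ → Ω → 𝕏) (S : Set 𝕏) (s n : ℕ) : Set Ω :=
  {ω | (∀ j < n, Y (s + j + 1) ω ∉ S) ∧ Y (s + n + 1) ω ∈ S}

theorem measurableSet_firstHit [MeasurableSpace 𝕏] [MeasurableSpace Ω] {Y : ℕ → Ω → 𝕏}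
    (hY : ∀ t, Measurable (Y t)) {S : Set 𝕏}
    (hS : MeasurableSet S) (s n : ℕ) : MeasurableSet (firstHit Y S s n) := by
  have : firstHit Y S s n
      = (⋂ j, ⋂ (_ : j < n), (Y (s + j + 1) ⁻¹' S)ᶜ) ∩ Y (s + n + 1) ⁻¹' S := by
    ext ω
    simp [firstHit]
  rw [this]
  exact (MeasurableSet.iInter fun j => MeasurableSet.iInter fun _ => (hY _ hS).compl).inter
    (hY _ hS)

theorem mem_firstHit_succ {Y : ℕ → Ω → 𝕏} {S : Set 𝕏} {s n : ℕ} {ω : Ω} :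
    ω ∈ firstHit Y S s (n + 1) ↔ Y (s + 1) ω ∉ S ∧ ω ∈ firstHit Y S (s + 1) n := by
  have h : ∀ j, s + 1 + j + 1 = s + (j + 1) + 1 := fun j => by ring
  simp only [firstHit, Set.mem_ofPred_eq, h, Nat.forall_lt_succ_left, and_assoc, add_zero]

theorem hittingAfter_one_eq_of_mem_firstHit {Y : ℕ → Ω → 𝕏} {S : Set 𝕏} {n : ℕ} {ω : Ω}
    (h : ω ∈ firstHit Y S 0 n) : hittingAfter Y S 1 ω = ((n + 1 : ℕ) : WithTop ℕ) := by
  obtain ⟨h1, h2⟩ := h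
  rw [zero_add] at h2
  refine le_antisymm (hittingAfter_le_of_mem (Nat.le_add_left 1 n) h2) (not_lt.1 fun hlt => ?_)
  obtain ⟨j, hj, hjS⟩ := hittingAfter_lt_iff.1 hlt
  obtain ⟨k, rfl⟩ := Nat.exists_eq_add_of_le' hj.1
  refine h1 k (Nat.lt_of_succ_lt_succ hj.2) ?_
  rwa [zero_add]

theorem hittingAfter_one_eq_top_of_forall_notMem_firstHit {Y : ℕ → Ω → 𝕏} {S : Set 𝕏} {ω : Ω}
    (h : ∀ n, ω ∉ firstHit Y S 0 n) : hittingAfter Y S 1 ω = ⊤ := by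
  rw [hittingAfter_eq_top_iff]
  intro j hj
  obtain ⟨k, rfl⟩ := Nat.exists_eq_add_of_le' hj
  induction k using Nat.strong_induction_on with
  | _ k ih =>
    intro hk
    refine h k ⟨fun i hi => ?_, by rwa [zero_add]⟩
    rw [zero_add]
    exact ih i hi (Nat.le_add_left 1 i)

/-- The general time s and past event E make the induction close: the event that step s + 1 misses S
is absorbed into E. -/
theorem IsMarkovFrom.setLIntegral_hitTerm [MeasurableSpace 𝕏] [MeasurableSpace Ω]
    {Q : Kernel 𝕏 𝕏} [IsMarkovKernel Q] {μ : Measure Ω}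
    [IsProbabilityMeasure μ] {Y : ℕ → Ω → 𝕏} {x : 𝕏} (h : IsMarkovFrom Q μ Y x)
    {S : Set 𝕏} (hS : MeasurableSet S) {φ : 𝕏 → ℝ≥0∞} (hφ : Measurable φ) (n s : ℕ)
    {E : Set Ω} (hE : MeasurableSet[⨆ r ≤ s, MeasurableSpace.comap (Y r) inferInstance] E) :
    ∫⁻ ω in E, hitTerm Q S φ n (Y s ω) ∂μ
      = ∫⁻ ω in E, (firstHit Y S s n).indicator (fun ω => φ (Y (s + n + 1) ω)) ω ∂μ := by
  induction n generalizing s E with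
  | zero =>
    simp only [hitTerm]
    rw [← h.setLIntegral_succ s hE (hφ.indicator hS)]
    refine lintegral_congr fun ω => ?_
    by_cases hω : Y (s + 1) ω ∈ S <;> simp [firstHit, Set.indicator, hω]
  | succ n ih =>
    have hpre : MeasurableSet (Y (s + 1) ⁻¹' Sᶜ) := h.measurable _ hS.compl
    have hE' : MeasurableSet[⨆ r ≤ s + 1, MeasurableSpace.comap (Y r) inferInstance]
        (Y (s + 1) ⁻¹' Sᶜ ∩ E) := by
      refine MeasurableSet.inter ?_ ?_
      · exact le_iSup₂_of_le (f := fun r (_ : r ≤ s + 1) =>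
          MeasurableSpace.comap (Y r) inferInstance) (s + 1) le_rfl le_rfl _
          ⟨Sᶜ, hS.compl, rfl⟩
      · exact (biSup_mono fun r hr => Nat.le_succ_of_le hr :
          (⨆ r ≤ s, MeasurableSpace.comap (Y r) inferInstance) ≤ _) _ hE
    simp only [hitTerm]
    rw [← h.setLIntegral_succ s hE ((measurable_hitTerm hS hφ n).indicator hS.compl)]
    have h1 := ih (s + 1) hE'
    rw [← Measure.restrict_restrict hpre, ← lintegral_indicator hpre,
      ← lintegral_indicator hpre] at h1
    refine Eq.trans ?_ (h1.trans ?_)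
    · rfl
    · refine lintegral_congr fun ω => ?_
      have ht : s + 1 + n + 1 = s + (n + 1) + 1 := by ring
      have hmem := mem_firstHit_succ (Y := Y) (S := S) (s := s) (n := n) (ω := ω)
      rw [← ht]
      by_cases hω : Y (s + 1) ω ∈ S <;> by_cases hω' : ω ∈ firstHit Y S (s + 1) n <;>
        simp [Set.indicator, hmem, hω, hω']

theorem IsMarkovFrom.lintegral_firstHit [MeasurableSpace 𝕏] [MeasurableSpace Ω]
    {Q : Kernel 𝕏 𝕏} [IsMarkovKernel Q] {μ : Measure Ω}
    [IsProbabilityMeasure μ] {Y : ℕ → Ω → 𝕏} {x : 𝕏} (h : IsMarkovFrom Q μ Y x)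
    {S : Set 𝕏} (hS : MeasurableSet S) {φ : 𝕏 → ℝ≥0∞} (hφ : Measurable φ) (n : ℕ) :
    ∫⁻ ω, (firstHit Y S 0 n).indicator (fun ω => φ (Y (n + 1) ω)) ω ∂μ = hitTerm Q S φ n x := by
  have h1 := h.setLIntegral_hitTerm hS hφ n 0 MeasurableSet.univ
  simp only [Measure.restrict_univ, zero_add] at h1
  rw [← h1, lintegral_congr_ae (g := fun _ => hitTerm Q S φ n x)
    (h.start.mono fun ω hω => by simp only [hω])]
  simp

/-- The events `firstHit Y S 0 n` are disjoint, so at most one term survives; none does when S is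
never hit. -/
theorem ofReal_discountedPayoff {δ : ℕ → ℝ} (hδ : ∀ k, 0 ≤ δ k) (f : 𝕏 → ℝ)
    (Y : ℕ → Ω → 𝕏) (S : Set 𝕏) (ω : Ω) :
    ENNReal.ofReal (discountedPayoff δ f Y (hittingAfter Y S 1) ω)
      = ∑' n, ENNReal.ofReal (δ (n + 1)) *
        (firstHit Y S 0 n).indicator (fun ω => ENNReal.ofReal (f (Y (n + 1) ω))) ω := by
  by_cases hex : ∃ n, ω ∈ firstHit Y S 0 n
  · obtain ⟨n, hn⟩ := hex
    have hρ := hittingAfter_one_eq_of_mem_firstHit hn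
    rw [tsum_eq_single n]
    · rw [discountedPayoff, hρ, Set.indicator_of_mem hn, ← ENNReal.ofReal_mul (hδ _)]
      rfl
    · intro m hm
      rw [Set.indicator_of_notMem, mul_zero]
      intro hm'
      have := (hittingAfter_one_eq_of_mem_firstHit hm').symm.trans hρ
      exact hm (Nat.succ_injective (WithTop.coe_injective this))
  · push Not at hex
    rw [discountedPayoff, hittingAfter_one_eq_top_of_forall_notMem_firstHit hex]
    simp [Set.indicator_of_notMem (hex _)]

theorem discountedPayoff_nonneg {δ : ℕ → ℝ} (hδ : ∀ k, 0 ≤ δ k) {f : 𝕏 → ℝ} (hf : ∀ x, 0 ≤ f x)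
    (Y : ℕ → Ω → 𝕏) (τ : Ω → WithTop ℕ) (ω : Ω) : 0 ≤ discountedPayoff δ f Y τ ω := by
  unfold discountedPayoff
  split
  · exact le_rfl
  · exact mul_nonneg (hδ _) (hf _)

theorem J_rho_eq [MeasurableSpace 𝕏] [MeasurableSpace Ω]
    {Q : Kernel 𝕏 𝕏} [IsMarkovKernel Q] {P : 𝕏 → Measure Ω}
    [∀ x, IsProbabilityMeasure (P x)] {X : 𝕏 → ℕ → Ω → 𝕏}
    (hX : ∀ x, IsMarkovFrom Q (P x) (X x) x) {δ : ℕ → ℝ} (hδ : ∀ k, 0 ≤ δ k) {f : 𝕏 → ℝ}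
    (hf : ∀ x, 0 ≤ f x) (hf_meas : Measurable f) {S : Set 𝕏} (hS : MeasurableSet S) (x : 𝕏) :
    J δ f P X x (rho X x S) = (discountedHit (fun k => ENNReal.ofReal (δ k)) Q S
      (fun y => ENNReal.ofReal (f y)) x).toReal := by
  have hterm : ∀ n, Measurable fun ω =>
      (firstHit (X x) S 0 n).indicator (fun ω => ENNReal.ofReal (f (X x (n + 1) ω))) ω := fun n =>
    (ENNReal.measurable_ofReal.comp (hf_meas.comp ((hX x).measurable _))).indicator
      (measurableSet_firstHit (hX x).measurable hS 0 n)
  have hpay := ofReal_discountedPayoff hδ f (X x) S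
  have hnn := discountedPayoff_nonneg hδ hf (X x) (hittingAfter (X x) S 1)
  -- Measurability is read off the series, without treating the hitting time itself.
  have hmeas : Measurable (discountedPayoff δ f (X x) (hittingAfter (X x) S 1)) := by
    have : discountedPayoff δ f (X x) (hittingAfter (X x) S 1) = fun ω => (∑' n,
        ENNReal.ofReal (δ (n + 1)) * (firstHit (X x) S 0 n).indicator
          (fun ω => ENNReal.ofReal (f (X x (n + 1) ω))) ω).toReal := by
      funext ω
      rw [← hpay, ENNReal.toReal_ofReal (hnn ω)]
    rw [this]
    exact (Measurable.tsum fun n => (hterm n).const_mul _).ennreal_toReal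
  rw [J, rho, integral_eq_lintegral_of_nonneg_ae (ae_of_all _ hnn) hmeas.aestronglyMeasurable]
  simp only [hpay]
  rw [lintegral_tsum fun n => ((hterm n).const_mul _).aemeasurable]
  congr 1
  refine tsum_congr fun n => ?_
  rw [lintegral_const_mul _ (hterm n),
    (hX x).lintegral_firstHit hS (φ := fun y => ENNReal.ofReal (f y)) hf_meas.ennreal_ofReal]

end Hitting

/-! ### Lower semicontinuity of the value of waiting -/

section Semicontinuity

variable {𝕏 : Type*} [TopologicalSpace 𝕏] [FirstCountableTopology 𝕏] [MeasurableSpace 𝕏]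
  {Q : Kernel 𝕏 𝕏} [IsMarkovKernel Q]

theorem KernelLSC.lowerSemicontinuous_lintegral (hQ : KernelLSC Q) {g : 𝕏 → ℝ≥0∞}
    (hg : Measurable g) {c : ℝ≥0∞} (hc : c ≠ ∞) (hgc : ∀ y, g y ≤ c) :
    LowerSemicontinuous fun x => ∫⁻ y, g y ∂(Q x) := by
  have hfin : ∀ x, ∫⁻ y, g y ∂(Q x) ≠ ∞ := fun x =>
    ((lintegral_mono hgc).trans_lt (by simpa using hc.lt_top)).ne
  have hint : ∀ x, ∫ y, (g y).toReal ∂(Q x) = (∫⁻ y, g y ∂(Q x)).toReal := fun x =>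
    integral_toReal hg.aemeasurable (ae_of_all _ fun y => (hgc y).trans_lt hc.lt_top)
  intro x b hb
  by_contra hcon
  obtain ⟨u, hu, hub⟩ := exists_seq_forall_of_frequently (not_eventually.1 hcon)
  have hb' : b ≠ ∞ := hb.ne_top
  have h1 := hQ (fun y => (g y).toReal) hg.ennreal_toReal
    ⟨c.toReal, fun y => by
      rw [abs_of_nonneg ENNReal.toReal_nonneg]
      exact ENNReal.toReal_mono hc (hgc y)⟩ u x hu
  have h2 : liminf (fun n => ∫ y, (g y).toReal ∂(Q (u n))) atTop ≤ b.toReal := by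
    -- A real `liminf` is meaningful only with a lower bound, here 0.
    refine liminf_le_of_frequently_le (Frequently.of_forall fun n => ?_) ?_
    · rw [hint]
      exact ENNReal.toReal_mono hb' (not_lt.1 (hub n))
    · exact isBoundedUnder_of ⟨0, fun n => integral_nonneg fun y => ENNReal.toReal_nonneg⟩
  have h3 := h1.trans h2
  rw [hint, ENNReal.toReal_le_toReal (hfin x) hb'] at h3
  exact absurd hb (not_lt.2 h3)

/-- No regularity of S or φ beyond measurability is needed: each term is one application of Q to a
bounded measurable function, and nonnegative series preserve lower semicontinuity. -/
theorem KernelLSC.lowerSemicontinuous_discountedHit (hQ : KernelLSC Q) {S : Set 𝕏}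
    (hS : MeasurableSet S) {φ : 𝕏 → ℝ≥0∞} (hφ : Measurable φ) {c : ℝ≥0∞} (hc : c ≠ ∞)
    (hφc : ∀ y, φ y ≤ c) {d : ℕ → ℝ≥0∞} (hd : ∀ n, d n ≠ ∞) :
    LowerSemicontinuous (discountedHit d Q S φ) := by
  have hbdd : ∀ n x, hitTerm Q S φ n x ≤ c := by
    intro n
    induction n with
    | zero =>
      intro x
      refine (lintegral_mono (g := fun _ => c) fun y => ?_).trans (by simp)
      exact (Set.indicator_le_self _ _ _).trans (hφc y)
    | succ n ih =>
      intro x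
      refine (lintegral_mono (g := fun _ => c) fun y => ?_).trans (by simp)
      exact (Set.indicator_le_self _ _ _).trans (ih y)
  refine lowerSemicontinuous_tsum fun n => ?_
  have hlsc : LowerSemicontinuous (hitTerm Q S φ n) := by
    cases n with
    | zero =>
      exact hQ.lowerSemicontinuous_lintegral (hφ.indicator hS) hc fun y =>
        (Set.indicator_le_self _ _ _).trans (hφc y)
    | succ n =>
      exact hQ.lowerSemicontinuous_lintegral ((measurable_hitTerm hS hφ n).indicator hS.compl) hc
        fun y => (Set.indicator_le_self _ _ _).trans (hbdd n y)
  exact (ENNReal.continuous_const_mul (hd (n + 1))).comp_lowerSemicontinuous hlsc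
    fun _ _ hab => mul_le_mul_right hab _

end Semicontinuity

/-! ### The least strict waiting set -/

section Minimal

variable {𝕏 : Type*} [MeasurableSpace 𝕏]

/-- Measurable sets outside which waiting for the set is strictly better than stopping. -/
def strictWaitingSets (Φ : Set 𝕏 → 𝕏 → ℝ≥0∞) (φ : 𝕏 → ℝ≥0∞) : Set (Set 𝕏) :=
  {S | MeasurableSet S ∧ ∀ y ∉ S, φ y < Φ S y}

/-- If shrinking a set can only increase the value `Φ` whenever stopping in the removed part is
dominated, then the smallest strict waiting set exists, is a fixed point of `S ↦ {Φ S ≤ φ}`, and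
has the largest value among all strict waiting sets. -/
theorem sInter_strictWaitingSets [TopologicalSpace 𝕏] [OpensMeasurableSpace 𝕏]
    {Φ : Set 𝕏 → 𝕏 → ℝ≥0∞} {φ : 𝕏 → ℝ≥0∞} (hφ : Measurable φ)
    (hΦ : ∀ S, MeasurableSet S → LowerSemicontinuous (Φ S))
    (himp : ∀ (W : Set (Set 𝕏)) (R : Set 𝕏), MeasurableSet R →
      (∀ S ∈ W, MeasurableSet S ∧ R ⊆ S) → (∀ y ∉ R, ∃ S ∈ W, φ y ≤ Φ S y) →
      ∀ S ∈ W, ∀ x, Φ S x ≤ Φ R x) :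
    MeasurableSet (⋂₀ strictWaitingSets Φ φ) ∧
      {x | Φ (⋂₀ strictWaitingSets Φ φ) x ≤ φ x} = ⋂₀ strictWaitingSets Φ φ ∧
      ∀ S ∈ strictWaitingSets Φ φ, ∀ x, Φ S x ≤ Φ (⋂₀ strictWaitingSets Φ φ) x := by
  set W := strictWaitingSets Φ φ with hW
  set R := ⋂₀ W with hR
  -- The comparison with the single set S: passing to {Φ S ≤ φ} ⊆ S removes only points where
  -- waiting for S is strictly better.
  have hfix : ∀ S ∈ W, {x | Φ S x ≤ φ x} ∈ W := by
    intro S hS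
    have hm : MeasurableSet {x | Φ S x ≤ φ x} := measurableSet_le (hΦ S hS.1).measurable hφ
    refine ⟨hm, fun y hy => ?_⟩
    refine (not_le.1 hy).trans_le (himp {S} _ hm ?_ ?_ S rfl y)
    · rintro _ rfl
      exact ⟨hS.1, fun x hx => by_contra fun h => not_lt.2 hx (hS.2 x h)⟩
    · exact fun z hz => ⟨S, rfl, (not_le.1 hz).le⟩
  have hReq : R = {x | (⨆ S ∈ W, Φ S x) ≤ φ x} := by
    ext x
    refine ⟨fun hx => ?_, fun hx S hS => ?_⟩
    · have h : ∀ S ∈ W, Φ S x ≤ φ x := fun S hS => Set.mem_sInter.1 hx _ (hfix S hS)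
      exact iSup₂_le (f := fun S (_ : S ∈ W) => Φ S x) h
    by_contra h
    exact absurd (hS.2 x h) (not_lt.2 ((le_iSup₂ (f := fun S (_ : S ∈ W) => Φ S x) S hS).trans hx))
  have hRm : MeasurableSet R := by
    rw [hReq]
    -- An arbitrary supremum of lower semicontinuous functions is again one, so W need not be
    -- countable.
    exact measurableSet_le (lowerSemicontinuous_biSup fun S hS => hΦ S hS.1).measurable hφ
  have hle : ∀ S ∈ W, ∀ x, Φ S x ≤ Φ R x := by
    refine himp W R hRm (fun S hS => ⟨hS.1, Set.sInter_subset_of_mem hS⟩) fun y hy => ?_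
    obtain ⟨S, hS, hyS⟩ : ∃ S ∈ W, y ∉ S := by simpa [hR] using hy
    exact ⟨S, hS, (hS.2 y hyS).le⟩
  have hRW : R ∈ W := by
    refine ⟨hRm, fun y hy => ?_⟩
    obtain ⟨S, hS, hyS⟩ : ∃ S ∈ W, y ∉ S := by simpa [hR] using hy
    exact (hS.2 y hyS).trans_le (hle S hS y)
  refine ⟨hRm, Set.Subset.antisymm (fun x hx => ?_) (Set.sInter_subset_of_mem (hfix R hRW)), hle⟩
  by_contra h
  exact not_lt.2 hx (hRW.2 x h)

end Minimal

end StoppingGame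

/-! ### The optimal equilibrium and its uniqueness -/

theorem theorem3 {𝕏 Ω : Type*} [TopologicalSpace 𝕏] [PolishSpace 𝕏] [MeasurableSpace 𝕏]
    [BorelSpace 𝕏] [MeasurableSpace Ω]
    (Q : Kernel 𝕏 𝕏) [IsMarkovKernel Q]
    (P : 𝕏 → Measure Ω) [∀ x, IsProbabilityMeasure (P x)]
    (X : 𝕏 → ℕ → Ω → 𝕏) (hX : ∀ x, StoppingGame.IsMarkovFrom Q (P x) (X x) x)
    (δ : ℕ → ℝ) (hδ : StoppingGame.IsDiscount δ)
    (hDI : ∀ i j : ℕ, δ i * δ j ≤ δ (i + j))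
    (f : 𝕏 → ℝ) (hf_nonneg : ∀ x, 0 ≤ f x) (hf_bdd : ∃ C : ℝ, ∀ x, f x ≤ C)
    (hf_meas : Measurable f) (hf_lsc : LowerSemicontinuous f)
    (hQ : StoppingGame.KernelLSC Q) :
    StoppingGame.IsOptimalEquilibrium δ f P X (⋂₀ StoppingGame.equilibria δ f P X) ∧
      ∀ T : Set 𝕏, StoppingGame.IsOptimalEquilibrium δ f P X T →
        T = ⋂₀ StoppingGame.equilibria δ f P X := by
  obtain ⟨C, hC⟩ := hf_bdd
  have hδ0 : ∀ k, 0 ≤ δ k := fun k => (hδ.mem_Icc k).1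
  set φ : 𝕏 → ℝ≥0∞ := fun y => ENNReal.ofReal (f y) with hφdef
  set d : ℕ → ℝ≥0∞ := fun k => ENNReal.ofReal (δ k) with hd
  have hφ : Measurable φ := hf_meas.ennreal_ofReal
  have hφc : ∀ y, φ y ≤ ENNReal.ofReal C := fun y => ENNReal.ofReal_le_ofReal (hC y)
  have hdmul : ∀ i j, d i * d j ≤ d (i + j) := fun i j => by
    simp only [hd]
    rw [← ENNReal.ofReal_mul (hδ0 i)]
    exact ENNReal.ofReal_le_ofReal (hDI i j)
  have hdanti : ∀ n, d (n + 1) ≤ d 1 := fun n =>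
    ENNReal.ofReal_le_ofReal (hδ.strictAnti.antitone (Nat.le_add_left 1 n))
  have hd1 : d 1 < 1 := by
    rw [← ENNReal.ofReal_one, ← hδ.zero]
    exact (ENNReal.ofReal_lt_ofReal_iff (by rw [hδ.zero]; exact one_pos)).2
      (hδ.strictAnti one_pos)
  set Φ : Set 𝕏 → 𝕏 → ℝ≥0∞ := fun S => StoppingGame.discountedHit d Q S φ with hΦ
  have hfin : ∀ S, MeasurableSet S → ∀ x, Φ S x ≠ ∞ := fun S hS x =>
    ((StoppingGame.discountedHit_le hS hdanti hd1.le hφc x).trans_lt ENNReal.ofReal_lt_top).ne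
  have hJ : ∀ S, MeasurableSet S → ∀ x,
      StoppingGame.J δ f P X x (StoppingGame.rho X x S) = (Φ S x).toReal := fun S hS x =>
    StoppingGame.J_rho_eq hX hδ0 hf_nonneg hf_meas hS x
  have hTheta : ∀ S, MeasurableSet S → StoppingGame.Theta δ f P X S = {x | Φ S x ≤ φ x} := by
    intro S hS
    ext x
    change StoppingGame.J δ f P X x (StoppingGame.rho X x S) ≤ f x ↔ Φ S x ≤ φ x
    rw [hJ S hS, ← ENNReal.le_ofReal_iff_toReal_le (hfin S hS x) (hf_nonneg x)]
  obtain ⟨hRm, hRfix, hRle⟩ := StoppingGame.sInter_strictWaitingSets (Φ := Φ) hφ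
    (fun S hS => hQ.lowerSemicontinuous_discountedHit hS hφ ENNReal.ofReal_ne_top hφc
      fun n => ENNReal.ofReal_ne_top)
    (fun W R hR hW h S hS x => StoppingGame.discountedHit_le_of_forall_notMem
      (B := fun S : W => (S : Set 𝕏)) hdmul hdanti hd1 (fun S => (hW S S.2).2) hR
      (fun S => (hW S S.2).1) hφ ENNReal.ofReal_ne_top hφc
      (fun y hy => by
        obtain ⟨S, hS, hyS⟩ := h y hy
        exact hyS.trans (le_iSup (fun S : W => StoppingGame.discountedHit d Q S φ y) ⟨S, hS⟩))
      ⟨S, hS⟩ x)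
  have hsub : ∀ S ∈ StoppingGame.equilibria δ f P X,
      S ∈ StoppingGame.strictWaitingSets Φ φ := by
    rintro S ⟨hS, hSfix⟩
    refine ⟨hS, fun y hy => ?_⟩
    rw [← hSfix, hTheta S hS] at hy
    exact not_le.1 hy
  have hReq : ⋂₀ StoppingGame.strictWaitingSets Φ φ ∈ StoppingGame.equilibria δ f P X :=
    ⟨hRm, (hTheta _ hRm).trans hRfix⟩
  have hinter : ⋂₀ StoppingGame.equilibria δ f P X = ⋂₀ StoppingGame.strictWaitingSets Φ φ :=
    Set.Subset.antisymm (Set.sInter_subset_of_mem hReq) (Set.sInter_subset_sInter hsub)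
  rw [hinter]
  refine ⟨⟨hReq, fun S hS x => ?_⟩, fun T hT => ?_⟩
  · refine max_le_max le_rfl ?_
    rw [hJ S hS.1, hJ _ hRm]
    exact ENNReal.toReal_mono (hfin _ hRm x) (hRle S (hsub S hS) x)
  -- On an optimal T the value is f, and it dominates the value of the least equilibrium; so
  -- stopping is also optimal there against that set.
  · refine Set.Subset.antisymm (fun x hx => ?_) (Set.sInter_subset_of_mem (hsub T hT.1))
    rw [← hT.1.2] at hx
    rw [← hReq.2]
    exact (le_max_right _ _).trans ((hT.2 _ hReq x).trans (max_le le_rfl hx))
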